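/- Let $c>0$ and $\lambda>0$, and let $X(t)$, $t\ge 0$, be the (Goldstein–Kac) telegraph process with speed $c$ and rate $\lambda$: the position at time $t$ of a particle that starts at the origin of the real line at time $0$, moves with constant speed $c$, chooses its initial direction (positive or negative) with probability $1/2$ each, and reverses its direction at each event of a homogeneous Poisson process of rate $\lambda$ that is independent of the initial direction. Then for every $t>0$ and $x\in\mathbb R$ the probability distribution function of $X(t)$ is $$\Pr\{X(t)<x\}=\begin{cases}0, & x\in(-\infty,-ct],\\[4pt] \dfrac12+\dfrac{\lambda x\,e^{-\lambda t}}{2c}\displaystyle\sum_{k=0}^{\infty}\frac{1}{(k!)^2}\left(\frac{\lambda t}{2}\right)^{2k}\left(1+\frac{\lambda t}{2k+2}\right)F\!\left(-k,\frac12;\frac32;\frac{x^2}{c^2t^2}\right), & x\in(-ct,ct],\\[4pt] 1, & x\in(ct,+\infty),\end{cases}$$ where the series converges and $F(\xi,\eta;\zeta;z)=\sum_{n=0}^{\infty}\frac{(\xi)_n(\eta)_n}{(\zeta)_n}\frac{z^n}{n!}$ is the Gauss hypergeometric function, with $(a)_n=a(a+1)\cdots(a+n-1)$ and $(a)_0=1$.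 -/

import Mathlib

open MeasureTheory ProbabilityTheory
open scoped NNReal

noncomputable section

/-- `N` is (under `μ`) a homogeneous Poisson process of rate `lam`: it almost surely starts at `0`
and has nondecreasing, right-continuous `ℕ`-valued paths, and it has independent increments, the
increment over `[s, t]` being Poisson distributed with parameter `lam * (t - s)`. (The subtraction
of natural numbers is almost surely a true one since the paths are nondecreasing.) -/
structure IsPoissonProcess {Ω : Type*} [MeasurableSpace Ω] (lam : ℝ≥0) (N : ℝ≥0 → Ω → ℕ)
    (μ : Measure Ω) : Prop where
  measurable : ∀ t, Measurable (N t)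
  zero : ∀ᵐ ω ∂μ, N 0 ω = 0
  monotone : ∀ᵐ ω ∂μ, Monotone fun t => N t ω
  rightContinuous : ∀ᵐ ω ∂μ, ∀ t, ContinuousWithinAt (fun s => N s ω) (Set.Ici t) t
  indep : HasIndepIncrements N μ
  law : ∀ s t, s ≤ t → HasLaw (fun ω => N t ω - N s ω) (poissonMeasure (lam * (t - s))) μ

/-- Position at time `t` of a particle that starts at the origin at time `0`, moves at speed `c`,
has initial direction `D` (`1` or `-1`) and reverses its direction at each event counted by `N`,
so that its velocity at time `s` is `c * D * (-1) ^ N s`. -/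
def telegraphPosition {Ω : Type*} (c : ℝ) (D : Ω → ℝ) (N : ℝ≥0 → Ω → ℕ) (t : ℝ≥0) (ω : Ω) : ℝ :=
  ∫ s in (0 : ℝ)..(t : ℝ), c * D ω * (-1) ^ N s.toNNReal ω

/-- `X` is (under `μ`) a telegraph process with speed `c` and rate `lam`: the position of a
particle whose initial direction is `1` or `-1` with probability `1/2` each and whose reversals are
the events of a homogeneous Poisson process of rate `lam` independent of the initial direction. -/
def IsTelegraphProcess {Ω : Type*} [MeasurableSpace Ω] (c : ℝ) (lam : ℝ≥0) (X : ℝ≥0 → Ω → ℝ)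
    (μ : Measure Ω) : Prop :=
  ∃ (D : Ω → ℝ) (N : ℝ≥0 → Ω → ℕ),
    Measurable D ∧ μ {ω | D ω = 1} = 1 / 2 ∧ μ {ω | D ω = -1} = 1 / 2 ∧
    IsPoissonProcess lam N μ ∧
    IndepFun D (fun ω t => N t ω) μ ∧
    ∀ᵐ ω ∂μ, ∀ t, X t ω = telegraphPosition c D N t ω

/-- The `k`-th term of the series in the distribution function of the telegraph process at time
`t`; `₂F₁` is the Gauss hypergeometric function. -/
def telegraphTerm (c lam t x : ℝ) (k : ℕ) : ℝ :=
  1 / (k.factorial : ℝ) ^ 2 * (lam * t / 2) ^ (2 * k) * (1 + lam * t / (2 * k + 2)) *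
    ₂F₁ (-(k : ℝ)) (1 / 2 : ℝ) (3 / 2 : ℝ) (x ^ 2 / (c ^ 2 * t ^ 2))

end

/-! The law of `X t / (c t)` is identified through its moment generating function, and its
distribution function is then read off. Write Y for the displacement with unit speed and initial
direction `1`, and ε for the parity `(-1)^N`. Since dY = ε dt, the functions u = E cosh(bY) and w =
E[ε sinh(bY)] satisfy u' = b w and w' = b u - 2λ w. The damping comes from E (-1)^(N t - N s) =
exp(-2λ(t - s)) and from the independence of that increment from the path up to s. Solving gives u =
e^{-λt}(cosh κt + (λ/κ) sinh κt), with κ² = λ² + b² (`integral_cosh_displacement`). The symmetric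
independent direction leaves only the even part of the exponential, so u is the full moment
generating function.

On the other side, put T = λt and expand cosh and sinh of √(T² + a²) in powers of T² and a². Terms
free of T sum to cosh a, the transform of two atoms at ±1. The other terms regroup into transforms
of the densities (1 - u²)^k (`hasSum_telegraphWeight_mul_integral`). Hence the explicit
`telegraphMeasure` has the same transform, and bounded laws are determined by it
(`map_eq_of_mgf_eq_of_bounded`).

Finally, integrating (1 - u²)^k from 0 to z gives z F(-k, 1/2; 3/2; z²), while symmetry of the law
supplies the 1/2. -/

section

open Filter Topology Set

/-! ### Regular paths, grid approximation and measurability -/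

section Poisson

/-- A Poisson process all of whose paths are regular. -/
structure IsRegularPoissonProcess {Ω : Type*} [MeasurableSpace Ω] (lam : ℝ≥0) (N : ℝ≥0 → Ω → ℕ)
    (μ : Measure Ω) : Prop extends IsPoissonProcess lam N μ where
  zero_all : ∀ ω, N 0 ω = 0
  monotone_all : ∀ ω, Monotone fun t => N t ω
  rightContinuous_all : ∀ ω t, ContinuousWithinAt (fun s => N s ω) (Set.Ici t) t

/-- Paths are replaced by the zero path on a measurable null set containing all bad outcomes; laws
and independence only see the process almost surely. -/
lemma IsPoissonProcess.exists_regular {Ω : Type*} [MeasurableSpace Ω] {lam : ℝ≥0}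
    {N : ℝ≥0 → Ω → ℕ} {μ : Measure Ω} (hN : IsPoissonProcess lam N μ) :
    ∃ N' : ℝ≥0 → Ω → ℕ, IsRegularPoissonProcess lam N' μ ∧ ∀ᵐ ω ∂μ, ∀ t, N' t ω = N t ω := by
  classical
  have hgood := (hN.zero.and hN.monotone).and hN.rightContinuous
  obtain ⟨B, hsub, hB, hB0⟩ := exists_measurable_superset_of_null (ae_iff.1 hgood)
  have hmem : ∀ ω, ω ∉ B → (N 0 ω = 0 ∧ Monotone fun t => N t ω) ∧
      ∀ t, ContinuousWithinAt (fun s => N s ω) (Set.Ici t) t := by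
    intro ω hω
    by_contra h
    exact hω (hsub h)
  let N' : ℝ≥0 → Ω → ℕ := fun t ω => if ω ∈ B then 0 else N t ω
  have hae : ∀ᵐ ω ∂μ, ∀ t, N' t ω = N t ω := by
    have : ∀ᵐ ω ∂μ, ω ∉ B := by simpa [ae_iff] using hB0
    filter_upwards [this] with ω hω t
    simp [N', hω]
  have hae' : ∀ s t, (fun ω => N t ω - N s ω) =ᵐ[μ] fun ω => N' t ω - N' s ω := by
    intro s t
    filter_upwards [hae] with ω hω
    rw [hω, hω]
  have hmono : ∀ ω, Monotone fun t => N' t ω := by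
    intro ω
    by_cases hω : ω ∈ B
    · simp only [N', hω, if_true]; exact monotone_const
    · simpa only [N', hω, if_false] using (hmem ω hω).1.2
  have hrc : ∀ ω t, ContinuousWithinAt (fun s => N' s ω) (Set.Ici t) t := by
    intro ω
    by_cases hω : ω ∈ B
    · simp only [N', hω, if_true]; exact fun t => continuousWithinAt_const
    · simpa only [N', hω, if_false] using (hmem ω hω).2
  have hzero : ∀ ω, N' 0 ω = 0 := by
    intro ω
    by_cases hω : ω ∈ B
    · simp [N', hω]
    · simpa [N', hω] using (hmem ω hω).1.1
  refine ⟨N', ⟨⟨?_, .of_forall hzero, .of_forall hmono, .of_forall hrc, ?_, ?_⟩, hzero, hmono,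
    hrc⟩, hae⟩
  · exact fun t => Measurable.ite hB measurable_const (hN.measurable t)
  · intro n t ht
    exact (hN.indep n t ht).congr fun i => hae' _ _
  · intro s t hst
    exact (hN.law s t hst).congr (hae' s t).symm

variable {Ω : Type*} {mΩ : MeasurableSpace Ω} {μ : Measure Ω} {lam : ℝ≥0} {N : ℝ≥0 → Ω → ℕ}

/-- The `k`-th point of the grid of mesh `1 / (n + 1)` on `[0, s]`. -/
noncomputable def gridUp (s : ℝ≥0) (n k : ℕ) : ℝ≥0 := min s (k / (n + 1))

/-- Direction (relative to the initial one) at time `s`. -/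
noncomputable def parity (N : ℝ≥0 → Ω → ℕ) (s : ℝ) (ω : Ω) : ℝ := (-1) ^ N s.toNNReal ω

/-- Displacement at time `t` for unit speed and initial direction `1`. -/
noncomputable def displacement (N : ℝ≥0 → Ω → ℕ) (t : ℝ) (ω : Ω) : ℝ :=
  ∫ s in (0 : ℝ)..t, parity N s ω

/-- Displacement at time `s` of a path observed on a grid of mesh `1 / (n + 1)`. -/
noncomputable def gridDisplacement (s : ℝ≥0) (n : ℕ) (z : ℕ → ℕ) : ℝ :=
  ∫ r in (0 : ℝ)..s, (-1 : ℝ) ^ z ⌈r * (n + 1)⌉₊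

/-- Independence passes through measurable functions of the path. The grid version reads only
countably many coordinates, so it is such a function; the exact displacement is reached afterwards
as a limit. -/
lemma measurable_gridDisplacement (s : ℝ≥0) (n : ℕ) : Measurable (gridDisplacement s n) := by
  have h1 : Measurable fun p : ℕ × (ℕ → ℕ) => (-1 : ℝ) ^ p.2 p.1 :=
    measurable_from_prod_countable_right fun k =>
      (measurable_from_nat (f := fun m : ℕ => (-1 : ℝ) ^ m)).comp (measurable_pi_apply k)
  have h2 : Measurable fun p : (ℕ → ℕ) × ℝ => (-1 : ℝ) ^ p.1 ⌈p.2 * (n + 1)⌉₊ :=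
    h1.comp (((Nat.measurable_ceil.comp (measurable_snd.mul_const _))).prodMk measurable_fst)
  unfold gridDisplacement
  simp_rw [intervalIntegral.integral_of_le s.coe_nonneg]
  exact (h2.stronglyMeasurable.integral_prod_right).measurable

lemma abs_neg_one_pow_le (m : ℕ) : |(-1 : ℝ) ^ m| ≤ 1 := by simp

lemma abs_parity (s : ℝ) (ω : Ω) : |parity N s ω| = 1 := by simp [parity]

lemma abs_gridDisplacement_le (s : ℝ≥0) (n : ℕ) (z : ℕ → ℕ) : |gridDisplacement s n z| ≤ s := by
  have := intervalIntegral.norm_integral_le_of_norm_le_const (a := (0 : ℝ)) (b := s) (C := 1)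
    (f := fun r => (-1 : ℝ) ^ z ⌈r * (n + 1)⌉₊) (fun x _ => by simp)
  simpa [gridDisplacement] using this

lemma abs_displacement_le (t : ℝ) (ω : Ω) : |displacement N t ω| ≤ |t| := by
  have := intervalIntegral.norm_integral_le_of_norm_le_const (a := (0 : ℝ)) (b := t) (C := 1)
    (f := fun r => parity N r ω) (fun x _ => by simp [parity])
  simpa [displacement] using this

lemma tendsto_ceil_div {r : ℝ} (hr : 0 ≤ r) :
    Tendsto (fun n : ℕ => ((⌈r * (n + 1)⌉₊ : ℝ) / (n + 1))) atTop (𝓝 r) := by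
  have h := (tendsto_nat_ceil_mul_div_atTop hr).comp
    ((tendsto_natCast_atTop_atTop (R := ℝ)).comp (tendsto_add_atTop_nat 1))
  refine h.congr fun n => ?_
  simp

lemma le_ceil_div (r : ℝ) (n : ℕ) : r ≤ (⌈r * (n + 1)⌉₊ : ℝ) / (n + 1) := by
  rw [le_div_iff₀ (by positivity)]
  exact Nat.le_ceil _

namespace IsRegularPoissonProcess

/-- Rounding up approaches r from the right, where paths are continuous; the cap at s in `gridUp`
prevents looking past time s. -/
lemma tendsto_grid (hN : IsRegularPoissonProcess lam N μ) (s : ℝ≥0) {r : ℝ} (hr : 0 ≤ r)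
    (hrs : r ≤ s) (ω : Ω) :
    Tendsto (fun n : ℕ => (-1 : ℝ) ^ N (gridUp s n ⌈r * (n + 1)⌉₊) ω) atTop
      (𝓝 (parity N r ω)) := by
  have hlim : Tendsto (fun n : ℕ => gridUp s n ⌈r * (n + 1)⌉₊) atTop
      (𝓝[Ici r.toNNReal] r.toNNReal) := by
    refine tendsto_nhdsWithin_iff.2 ⟨?_, .of_forall fun n => ?_⟩
    · rw [← NNReal.tendsto_coe]
      have := (tendsto_const_nhds (x := (s : ℝ))).min (tendsto_ceil_div hr)
      rw [min_eq_right hrs] at this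
      simpa [gridUp, hr] using this
    · rw [mem_Ici, Real.toNNReal_le_iff_le_coe]
      simpa [gridUp] using ⟨hrs, le_ceil_div r n⟩
  have := (hN.rightContinuous_all ω r.toNNReal).tendsto.comp hlim
  exact ((continuous_of_discreteTopology (f := fun m : ℕ => (-1 : ℝ) ^ m)).tendsto _).comp this

lemma measurable_parity (hN : IsRegularPoissonProcess lam N μ) (s : ℝ) :
    Measurable (parity N s) :=
  (measurable_from_nat (f := fun m : ℕ => (-1 : ℝ) ^ m)).comp (hN.measurable _)

lemma tendsto_uniformGrid (hN : IsRegularPoissonProcess lam N μ) (r : ℝ) (ω : Ω) :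
    Tendsto (fun n : ℕ => parity N (⌈(r.toNNReal : ℝ) * (n + 1)⌉₊ / (n + 1)) ω) atTop
      (𝓝 (parity N r ω)) := by
  have hlim : Tendsto (fun n : ℕ => ((⌈(r.toNNReal : ℝ) * (n + 1)⌉₊ : ℝ) / (n + 1)).toNNReal)
      atTop (𝓝[Ici r.toNNReal] r.toNNReal) := by
    refine tendsto_nhdsWithin_iff.2 ⟨?_, .of_forall fun n => ?_⟩
    · have h := (continuous_real_toNNReal.tendsto _).comp (tendsto_ceil_div r.toNNReal.coe_nonneg)
      rw [Real.toNNReal_coe] at h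
      exact h
    · have h := Real.toNNReal_le_toNNReal (le_ceil_div (r.toNNReal : ℝ) n)
      rw [Real.toNNReal_coe] at h
      exact h
  have := (hN.rightContinuous_all ω r.toNNReal).tendsto.comp hlim
  exact ((continuous_of_discreteTopology (f := fun m : ℕ => (-1 : ℝ) ^ m)).tendsto _).comp this

/-- Right-continuity makes the parity a pointwise limit of processes whose time variable takes
countably many values. -/
lemma measurable_parity_uncurry (hN : IsRegularPoissonProcess lam N μ) :
    Measurable fun p : ℝ × Ω => parity N p.1 p.2 := by
  have h1 (n : ℕ) : Measurable fun p : ℕ × Ω => parity N ((p.1 : ℝ) / (n + 1)) p.2 :=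
    measurable_from_prod_countable_right fun k => hN.measurable_parity ((k : ℝ) / (n + 1))
  have h2 (n : ℕ) : Measurable fun p : ℝ × Ω => (⌈(p.1.toNNReal : ℝ) * (n + 1)⌉₊, p.2) :=
    (Nat.measurable_ceil.comp ((measurable_fst.real_toNNReal.coe_nnreal_real).mul_const
      _)).prodMk measurable_snd
  have h3 (n : ℕ) : Measurable fun p : ℝ × Ω =>
      parity N (⌈(p.1.toNNReal : ℝ) * (n + 1)⌉₊ / (n + 1)) p.2 := by
    simpa only [Function.comp_def] using (h1 n).comp (h2 n)
  exact measurable_of_tendsto_metrizable h3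
    (tendsto_pi_nhds.2 fun p => hN.tendsto_uniformGrid p.1 p.2)

lemma intervalIntegrable_parity (hN : IsRegularPoissonProcess lam N μ) (a b : ℝ) (ω : Ω) :
    IntervalIntegrable (fun s => parity N s ω) volume a b := by
  have hm : Measurable fun s => parity N s ω :=
    hN.measurable_parity_uncurry.comp (measurable_id.prodMk measurable_const)
  refine (intervalIntegrable_const (c := (1 : ℝ))).mono_fun hm.aestronglyMeasurable
    (.of_forall fun s => by simp [parity])

lemma continuous_displacement (hN : IsRegularPoissonProcess lam N μ) (ω : Ω) :
    Continuous fun t => displacement N t ω :=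
  intervalIntegral.continuous_primitive (fun a b => hN.intervalIntegrable_parity a b ω) 0

lemma measurable_displacement (hN : IsRegularPoissonProcess lam N μ) (t : ℝ) :
    Measurable (displacement N t) := by
  have h : StronglyMeasurable fun p : Ω × ℝ => parity N p.2 p.1 :=
    (hN.measurable_parity_uncurry.comp measurable_swap).stronglyMeasurable
  unfold displacement intervalIntegral
  exact (h.integral_prod_right).measurable.sub (h.integral_prod_right).measurable

lemma measurable_displacement_uncurry (hN : IsRegularPoissonProcess lam N μ) :
    Measurable fun p : ℝ × Ω => displacement N p.1 p.2 :=
  measurable_uncurry_of_continuous_of_measurable (u := displacement N)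
    hN.continuous_displacement hN.measurable_displacement

lemma tendsto_gridDisplacement (hN : IsRegularPoissonProcess lam N μ) (s : ℝ≥0) (ω : Ω) :
    Tendsto (fun n => gridDisplacement s n fun k => N (gridUp s n k) ω) atTop
      (𝓝 (displacement N s ω)) := by
  refine intervalIntegral.tendsto_integral_filter_of_dominated_convergence (fun _ => 1)
    (.of_forall fun n => ?_) (.of_forall fun n => .of_forall fun r _ => by simp)
    intervalIntegrable_const (.of_forall fun r hr => ?_)
  · refine Measurable.aestronglyMeasurable ?_
    exact (measurable_from_nat (f := fun k : ℕ => (-1 : ℝ) ^ N (gridUp s n k) ω)).comp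
      (Nat.measurable_ceil.comp (measurable_id.mul_const _))
  · rw [uIoc_of_le s.coe_nonneg] at hr
    exact hN.tendsto_grid s hr.1.le hr.2 ω

end IsRegularPoissonProcess

/-! ### Independence of an increment from the past displacement -/

/-- Factorisation of expectations passes to pointwise limits of independent approximations. -/
lemma integral_mul_comp_of_tendsto_indepFun [IsProbabilityMeasure μ] {Δ Y : Ω → ℝ}
    {Yn : ℕ → Ω → ℝ} {B C : ℝ} (hΔ : AEStronglyMeasurable Δ μ) (hΔB : ∀ᵐ ω ∂μ, |Δ ω| ≤ B)
    (hYn : ∀ n, Measurable (Yn n)) (hYC : ∀ n ω, |Yn n ω| ≤ C)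
    (hlim : ∀ ω, Tendsto (fun n => Yn n ω) atTop (𝓝 (Y ω)))
    (hind : ∀ n, IndepFun Δ (Yn n) μ) {g : ℝ → ℝ} (hg : Continuous g) :
    ∫ ω, Δ ω * g (Y ω) ∂μ = (∫ ω, Δ ω ∂μ) * ∫ ω, g (Y ω) ∂μ := by
  obtain ⟨M, hM⟩ := (isCompact_Icc (a := -C) (b := C)).exists_bound_of_continuousOn hg.continuousOn
  have hbd : ∀ n ω, |g (Yn n ω)| ≤ M := fun n ω => hM _ (abs_le.1 (hYC n ω))
  have hmeas : ∀ n, AEStronglyMeasurable (fun ω => g (Yn n ω)) μ :=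
    fun n => (hg.measurable.comp (hYn n)).aestronglyMeasurable
  have hgl : ∀ ω, Tendsto (fun n => g (Yn n ω)) atTop (𝓝 (g (Y ω))) :=
    fun ω => (hg.tendsto _).comp (hlim ω)
  have l1 : Tendsto (fun n => ∫ ω, Δ ω * g (Yn n ω) ∂μ) atTop (𝓝 (∫ ω, Δ ω * g (Y ω) ∂μ)) := by
    refine tendsto_integral_of_dominated_convergence (fun _ => B * M) (fun n => hΔ.mul (hmeas n))
      (integrable_const _) (fun n => ?_) (.of_forall fun ω => (hgl ω).const_mul _)
    filter_upwards [hΔB] with ω hω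
    rw [Real.norm_eq_abs, abs_mul]
    exact mul_le_mul hω (hbd n ω) (abs_nonneg _) ((abs_nonneg _).trans hω)
  have l2 : Tendsto (fun n => (∫ ω, Δ ω ∂μ) * ∫ ω, g (Yn n ω) ∂μ) atTop
      (𝓝 ((∫ ω, Δ ω ∂μ) * ∫ ω, g (Y ω) ∂μ)) := by
    refine Tendsto.const_mul _ ?_
    exact tendsto_integral_of_dominated_convergence (fun _ => M) hmeas
      (integrable_const _) (fun n => .of_forall fun ω => hbd n ω) (.of_forall hgl)
  refine tendsto_nhds_unique l1 (l2.congr fun n => ?_)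
  have := (hind n).comp (φ := id) measurable_id hg.measurable
  exact (this.integral_fun_mul_eq_mul_integral hΔ (hmeas n)).symm

/-- The Poisson generating function at -1: a normalising e^{-r} times the exponential series at -r.
-/
lemma integral_neg_one_pow_poissonMeasure (r : ℝ≥0) :
    ∫ n, (-1 : ℝ) ^ n ∂(poissonMeasure r) = Real.exp (-2 * r) := by
  rw [integral_poissonMeasure]
  have h := (NormedSpace.expSeries_div_hasSum_exp (-(r : ℝ))).mul_left (Real.exp (-r))
  rw [← Real.exp_eq_exp_ℝ, ← Real.exp_add] at h
  rw [show (-2 : ℝ) * r = -r + -r by ring, ← h.tsum_eq]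
  refine tsum_congr fun n => ?_
  rw [smul_eq_mul, neg_pow (r : ℝ)]
  ring

namespace IsRegularPoissonProcess

lemma integral_neg_one_pow_increment (hN : IsRegularPoissonProcess lam N μ) {s t : ℝ≥0}
    (hst : s ≤ t) :
    ∫ ω, (-1 : ℝ) ^ (N t ω - N s ω) ∂μ = Real.exp (-2 * lam * (t - s)) := by
  have h := (hN.law s t hst).integral_comp (f := fun n : ℕ => (-1 : ℝ) ^ n)
    (Measurable.aestronglyMeasurable (by fun_prop))
  simp only [Function.comp_def] at h
  rw [h, integral_neg_one_pow_poissonMeasure]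
  congr 1
  push_cast [NNReal.coe_sub hst]
  ring

/-- As paths start at 0, values up to index `K` are partial sums of increments preceding the last
one. Monotonicity makes the truncated differences telescope. -/
lemma indepFun_increment_past (hN : IsRegularPoissonProcess lam N μ) {τ : ℕ → ℝ≥0}
    (hτ : Monotone τ) (h0 : τ 0 = 0) (K : ℕ) :
    IndepFun (fun ω => N (τ (K + 1)) ω - N (τ K) ω) (fun ω (k : ℕ) => N (τ (min k K)) ω) μ := by
  have hi := hN.indep.nat hτ
  have hm : ∀ i, Measurable fun ω => N (τ (i + 1)) ω - N (τ i) ω :=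
    fun i => (hN.measurable _).sub (hN.measurable _)
  have h := hi.indepFun_finset {K} (Finset.range K) (by simp) hm
  have hφ : Measurable fun v : ({K} : Finset ℕ) → ℕ => v ⟨K, by simp⟩ := measurable_pi_apply _
  have hψ : Measurable fun (v : Finset.range K → ℕ) (k : ℕ) =>
      ∑ i ∈ (Finset.range K).attach.filter (fun i => i.1 < k), v i :=
    measurable_pi_lambda _ fun k => by fun_prop
  have h' := h.comp hφ hψ
  convert h' using 1
  · rfl
  funext ω k
  have hsum : ∑ i ∈ Finset.range (min k K), (N (τ (i + 1)) ω - N (τ i) ω) = N (τ (min k K)) ω := by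
    rw [Finset.sum_range_tsub (f := fun i => N (τ i) ω) ((hN.monotone_all ω).comp hτ), h0,
      hN.zero_all, Nat.sub_zero]
  rw [← hsum]
  simp only [Function.comp_apply]
  rw [Finset.sum_filter, Finset.sum_attach (Finset.range K)
    (fun i => if i < k then N (τ (i + 1)) ω - N (τ i) ω else 0), ← Finset.sum_filter]
  refine Finset.sum_congr ?_ fun _ _ => rfl
  ext i
  simp [and_comm]

lemma indepFun_increment_grid (hN : IsRegularPoissonProcess lam N μ) {s t : ℝ≥0} (hst : s ≤ t)
    (n : ℕ) :
    IndepFun (fun ω => N t ω - N s ω) (fun ω (k : ℕ) => N (gridUp s n k) ω) μ := by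
  set K : ℕ := ⌈(s : ℝ≥0) * (n + 1)⌉₊ with hK
  have hsK : ∀ k, K ≤ k → gridUp s n k = s := by
    intro k hk
    refine min_eq_left ?_
    rw [le_div_iff₀ (by positivity)]
    exact (Nat.le_ceil _).trans (Nat.cast_le.2 hk)
  have hgm : Monotone (gridUp s n) := fun a b hab => by
    unfold gridUp
    gcongr
  -- The grid has reached s by index `K`, so the increment from index `K` to `K + 1` is exactly the
  -- one over [s, t].
  let τ : ℕ → ℝ≥0 := fun k => if k ≤ K then gridUp s n k else t
  have hτ : Monotone τ := by
    intro a b hab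
    simp only [τ]
    split_ifs with h1 h2 h2
    · exact hgm hab
    · exact (min_le_left _ _).trans hst
    · omega
    · rfl
  have h := hN.indepFun_increment_past hτ (by simp [τ, gridUp]) K
  have e1 : τ (K + 1) = t := by simp [τ]
  have e2 : τ K = s := by simp [τ, hsK K le_rfl]
  have e3 : ∀ k, τ (min k K) = gridUp s n k := by
    intro k
    rcases le_total k K with hk | hk
    · simp [τ, hk]
    · rw [min_eq_right hk, e2, hsK k hk]
  simpa only [e1, e2, e3] using h

lemma integral_parity_mul_parity_mul_comp [IsProbabilityMeasure μ]
    (hN : IsRegularPoissonProcess lam N μ) {s t : ℝ}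
    (hs : 0 ≤ s) (hst : s ≤ t) {g : ℝ → ℝ} (hg : Continuous g) :
    ∫ ω, parity N t ω * parity N s ω * g (displacement N s ω) ∂μ =
      Real.exp (-2 * lam * (t - s)) * ∫ ω, g (displacement N s ω) ∂μ := by
  lift s to ℝ≥0 using hs
  lift t to ℝ≥0 using s.coe_nonneg.trans hst
  have hst' : s ≤ t := by exact_mod_cast hst
  rw [← hN.integral_neg_one_pow_increment hst']
  have hm : Measurable fun ω => (-1 : ℝ) ^ (N t ω - N s ω) :=
    (measurable_from_nat (f := fun m : ℕ => (-1 : ℝ) ^ m)).comp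
      ((hN.measurable _).sub (hN.measurable _))
  rw [← integral_mul_comp_of_tendsto_indepFun hm.aestronglyMeasurable
    (.of_forall fun ω => abs_neg_one_pow_le _)
    (fun n => (measurable_gridDisplacement s n).comp
      (measurable_pi_lambda (fun ω (k : ℕ) => N (gridUp s n k) ω) fun k => hN.measurable _))
    (fun n ω => abs_gridDisplacement_le s n _) (hN.tendsto_gridDisplacement s)
    (fun n => (hN.indepFun_increment_grid hst' n).comp
      (measurable_from_nat (f := fun m : ℕ => (-1 : ℝ) ^ m)) (measurable_gridDisplacement s n)) hg]
  refine integral_congr_ae (.of_forall fun ω => ?_)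
  simp only [parity, Real.toNNReal_coe]
  congr 1
  -- The two parities multiply to that of the increment, since `N s` is counted twice.
  obtain ⟨d, hd⟩ := Nat.exists_eq_add_of_le (hN.monotone_all ω hst')
  simp only at hd
  rw [hd, Nat.add_sub_cancel_left, pow_add, mul_right_comm, ← mul_pow]
  simp

lemma integral_direction_mul_comp [IsProbabilityMeasure μ]
    (hN : IsRegularPoissonProcess lam N μ) {D : Ω → ℝ} (hD : Measurable D)
    (hD1 : ∀ᵐ ω ∂μ, |D ω| ≤ 1) (hind : IndepFun D (fun ω t => N t ω) μ)
    (s : ℝ≥0) {g : ℝ → ℝ} (hg : Continuous g) :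
    ∫ ω, D ω * g (displacement N s ω) ∂μ =
      (∫ ω, D ω ∂μ) * ∫ ω, g (displacement N s ω) ∂μ := by
  refine integral_mul_comp_of_tendsto_indepFun hD.aestronglyMeasurable hD1
    (fun n => (measurable_gridDisplacement s n).comp
      (measurable_pi_lambda (fun ω (k : ℕ) => N (gridUp s n k) ω) fun k => hN.measurable _))
    (fun n ω => abs_gridDisplacement_le s n _) (hN.tendsto_gridDisplacement s)
    (fun n => ?_) hg
  exact hind.comp (φ := id) measurable_id
    ((measurable_gridDisplacement s n).comp (measurable_pi_lambda
      (fun (v : ℝ≥0 → ℕ) (k : ℕ) => v (gridUp s n k)) fun k => measurable_pi_apply _))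

end IsRegularPoissonProcess

/-! ### Integral equations for expectations along the path -/

namespace IsRegularPoissonProcess

lemma hasDerivWithinAt_displacement (hN : IsRegularPoissonProcess lam N μ) (ω : Ω) {s : ℝ} :
    HasDerivWithinAt (fun t => displacement N t ω) (parity N s ω) (Ioi s) s := by
  have hm : Measurable fun s => parity N s ω :=
    hN.measurable_parity_uncurry.comp (measurable_id.prodMk measurable_const)
  refine (intervalIntegral.integral_hasDerivWithinAt_right (s := Ici s) (t := Ioi s)
    (hN.intervalIntegrable_parity 0 s ω)
    hm.stronglyMeasurable.stronglyMeasurableAtFilter ?_).mono Ioi_subset_Ici_self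
  have hlim : Tendsto Real.toNNReal (𝓝[Ici s] s) (𝓝[Ici s.toNNReal] s.toNNReal) :=
    tendsto_nhdsWithin_iff.2 ⟨(continuous_real_toNNReal.tendsto s).mono_left nhdsWithin_le_nhds,
      eventually_mem_nhdsWithin.mono fun x hx => Real.toNNReal_le_toNNReal hx⟩
  have h := (hN.rightContinuous_all ω s.toNNReal).tendsto.comp hlim
  have h' : ContinuousWithinAt (fun s => parity N s ω) (Ici s) s :=
    ((continuous_of_discreteTopology (f := fun m : ℕ => (-1 : ℝ) ^ m)).tendsto _).comp h
  exact h'.mono Ioi_subset_Ici_self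

lemma intervalIntegrable_parity_mul (hN : IsRegularPoissonProcess lam N μ) {g : ℝ → ℝ}
    (hg : Continuous g) (a b : ℝ) (ω : Ω) :
    IntervalIntegrable (fun s => parity N s ω * g (displacement N s ω)) volume a b :=
  (hN.intervalIntegrable_parity a b ω).mul_continuousOn
    (hg.comp (hN.continuous_displacement ω)).continuousOn

/-- The chain rule and the fundamental theorem of calculus, with right derivatives only, because the
velocity jumps at reversals. -/
lemma integral_parity_mul_deriv (hN : IsRegularPoissonProcess lam N μ) {f f' : ℝ → ℝ}
    (hf : ∀ y, HasDerivAt f (f' y) y) (hf' : Continuous f') (t : ℝ) (ω : Ω) :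
    ∫ s in (0 : ℝ)..t, parity N s ω * f' (displacement N s ω) =
      f (displacement N t ω) - f 0 := by
  have hcont : Continuous f := continuous_iff_continuousAt.2 fun y => (hf y).continuousAt
  rw [intervalIntegral.integral_eq_sub_of_hasDeriv_right
    (f := fun s => f (displacement N s ω))
    (hcont.comp (hN.continuous_displacement ω)).continuousOn (fun s _ => ?_)
    (hN.intervalIntegrable_parity_mul hf' 0 t ω)]
  · simp [displacement]
  · have := (hf (displacement N s ω)).comp_hasDerivWithinAt s
      (hN.hasDerivWithinAt_displacement ω (s := s))
    rwa [mul_comm] at this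

lemma measurable_parity_mul_uncurry (hN : IsRegularPoissonProcess lam N μ) {g : ℝ → ℝ}
    (hg : Continuous g) :
    Measurable fun p : ℝ × Ω => parity N p.1 p.2 * g (displacement N p.1 p.2) :=
  hN.measurable_parity_uncurry.mul (hg.measurable.comp hN.measurable_displacement_uncurry)

lemma intervalIntegrable_integral_parity_mul [IsProbabilityMeasure μ]
    (hN : IsRegularPoissonProcess lam N μ) {g : ℝ → ℝ} (hg : Continuous g) (a b : ℝ) :
    IntervalIntegrable (fun s => ∫ ω, parity N s ω * g (displacement N s ω) ∂μ) volume a b := by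
  obtain ⟨M, hM⟩ := (isCompact_Icc (a := -(max |a| |b|)) (b := max |a| |b|)).exists_bound_of_continuousOn
    hg.continuousOn
  have hm : StronglyMeasurable fun s => ∫ ω, parity N s ω * g (displacement N s ω) ∂μ :=
    (hN.measurable_parity_mul_uncurry hg).stronglyMeasurable.integral_prod_right
  rw [intervalIntegrable_iff]
  refine Measure.integrableOn_of_bounded (M := M) (by simp) hm.aestronglyMeasurable ?_
  refine (ae_restrict_iff' measurableSet_uIoc).2 (.of_forall fun s hs => ?_)
  have hs' : |s| ≤ max |a| |b| := by
    rcases le_total a b with h | h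
    · rw [uIoc_of_le h] at hs
      exact abs_le_max_abs_abs hs.1.le hs.2
    · rw [uIoc_of_ge h] at hs
      rw [max_comm]
      exact abs_le_max_abs_abs hs.1.le hs.2
  refine (norm_integral_le_of_norm_le_const (C := M) (.of_forall fun ω => ?_)).trans (by simp)
  rw [norm_mul, Real.norm_eq_abs, abs_parity, one_mul]
  exact hM _ (abs_le.1 ((abs_displacement_le s ω).trans hs'))

/-- The pathwise identity weighted by `h` and integrated with Fubini. The weight does not depend on
s: it will be `1`, or the parity at the terminal time. -/
lemma integral_mul_comp_displacement [IsProbabilityMeasure μ]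
    (hN : IsRegularPoissonProcess lam N μ) {f f' : ℝ → ℝ}
    (hf : ∀ y, HasDerivAt f (f' y) y) (hf' : Continuous f') {h : Ω → ℝ} (hh : Measurable h)
    (hh1 : ∀ ω, |h ω| ≤ 1) {t : ℝ} (ht : 0 ≤ t) :
    ∫ ω, h ω * f (displacement N t ω) ∂μ = f 0 * ∫ ω, h ω ∂μ +
      ∫ s in (0 : ℝ)..t, ∫ ω, h ω * (parity N s ω * f' (displacement N s ω)) ∂μ := by
  obtain ⟨M, hM⟩ := (isCompact_Icc (a := -t) (b := t)).exists_bound_of_continuousOn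
    hf'.continuousOn
  have hint : Integrable (Function.uncurry fun s ω =>
      h ω * (parity N s ω * f' (displacement N s ω))) ((volume.restrict (uIoc 0 t)).prod μ) := by
    have hm : Measurable (Function.uncurry fun s ω =>
      h ω * (parity N s ω * f' (displacement N s ω))) :=
      (hh.comp measurable_snd).mul (hN.measurable_parity_mul_uncurry hf')
    have : IsFiniteMeasure (volume.restrict (uIoc 0 t)) := ⟨by simp [uIoc]⟩
    refine Integrable.of_bound hm.aestronglyMeasurable M ?_
    refine (Measure.ae_prod_iff_ae_ae (measurableSet_le hm.norm measurable_const)).2 ?_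
    refine (ae_restrict_iff' measurableSet_uIoc).2 (.of_forall fun s hs => .of_forall fun ω => ?_)
    rw [uIoc_of_le ht] at hs
    have hb : ‖f' (displacement N s ω)‖ ≤ M := hM _ (abs_le.1 ((abs_displacement_le s ω).trans
      ((abs_of_pos hs.1).trans_le hs.2)))
    simp only [Function.uncurry, norm_mul]
    rw [Real.norm_eq_abs (parity N s ω), abs_parity, one_mul]
    exact (mul_le_of_le_one_left (norm_nonneg _) (hh1 ω)).trans hb
  rw [intervalIntegral_integral_swap hint]
  simp_rw [intervalIntegral.integral_const_mul, hN.integral_parity_mul_deriv hf hf', mul_sub]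
  have hcont : Continuous f := continuous_iff_continuousAt.2 fun y => (hf y).continuousAt
  obtain ⟨M', hM'⟩ := (isCompact_Icc (a := -|t|) (b := |t|)).exists_bound_of_continuousOn
    hcont.continuousOn
  have hhint : Integrable h μ := .of_bound hh.aestronglyMeasurable 1 (.of_forall hh1)
  rw [integral_sub ?_ (hhint.mul_const _), integral_mul_const]
  · ring
  · refine .of_bound (hh.mul (hcont.measurable.comp
      (hN.measurable_displacement t))).aestronglyMeasurable M' (.of_forall fun ω => ?_)
    rw [norm_mul]
    exact (mul_le_of_le_one_left (norm_nonneg _) (hh1 ω)).trans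
      (hM' _ (abs_le.1 (abs_displacement_le t ω)))

end IsRegularPoissonProcess

/-! ### Solving the system and computing E cosh(bY) -/

/-- The solution of the damped system `u' = b w`, `w' = b u - 2 l w`, `u 0 = 1`, `w 0 = 0`, given in
integrated form. -/
lemma eq_exp_mul_cosh_add_sinh_of_integral_eq {u w : ℝ → ℝ} {b l : ℝ} (hl : 0 < l)
    (hint : ∀ x y, IntervalIntegrable w volume x y)
    (hu : ∀ t, 0 ≤ t → u t = 1 + b * ∫ s in (0 : ℝ)..t, w s)
    (hw : ∀ t, 0 ≤ t → w t = b * ∫ s in (0 : ℝ)..t, Real.exp (-2 * l * (t - s)) * u s)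
    {t : ℝ} (ht : 0 ≤ t) :
    u t = Real.exp (-l * t) * (Real.cosh (√(l ^ 2 + b ^ 2) * t) +
      l / √(l ^ 2 + b ^ 2) * Real.sinh (√(l ^ 2 + b ^ 2) * t)) := by
  set κ := √(l ^ 2 + b ^ 2) with hκ
  have hκpos : 0 < κ := Real.sqrt_pos.2 (by positivity)
  have hκ2 : κ ^ 2 = l ^ 2 + b ^ 2 := Real.sq_sqrt (by positivity)
  -- The hypotheses concern t ≥ 0 only; freezing the functions at their value at 0 for negative
  -- times gives continuity on the whole line.
  let u₀ : ℝ → ℝ := fun t => u (max t 0)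
  let w₀ : ℝ → ℝ := fun t => w (max t 0)
  have hu₀ : Continuous u₀ := by
    have : u₀ = fun t => 1 + b * ∫ s in (0 : ℝ)..(max t 0), w s :=
      funext fun t => hu _ (le_max_right _ _)
    rw [this]
    exact continuous_const.add (continuous_const.mul
      ((intervalIntegral.continuous_primitive hint 0).comp (by fun_prop)))
  have hcu : Continuous fun s => Real.exp (2 * l * s) * u₀ s := by fun_prop
  let W : ℝ → ℝ := fun t =>
    Real.exp (-2 * l * t) * (b * ∫ s in (0 : ℝ)..t, Real.exp (2 * l * s) * u₀ s)
  have hW : ∀ t, 0 ≤ t → w t = W t := by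
    intro t ht
    have e : ∫ s in (0 : ℝ)..t, Real.exp (-2 * l * (t - s)) * u s =
        Real.exp (-2 * l * t) * ∫ s in (0 : ℝ)..t, Real.exp (2 * l * s) * u₀ s := by
      rw [← intervalIntegral.integral_const_mul]
      refine intervalIntegral.integral_congr fun s hs => ?_
      rw [uIcc_of_le ht] at hs
      simp only [u₀, max_eq_left hs.1]
      rw [← mul_assoc, ← Real.exp_add]
      ring_nf
    rw [hw t ht, e]
    exact mul_left_comm _ _ _
  have hWd : ∀ t, HasDerivAt W (b * u₀ t - 2 * l * W t) t := by
    intro t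
    have h1 := hcu.integral_hasStrictDerivAt 0 t |>.hasDerivAt
    have h2 : HasDerivAt (fun t => Real.exp (-2 * l * t)) (Real.exp (-2 * l * t) * (-2 * l)) t := by
      simpa using ((hasDerivAt_id t).const_mul (-2 * l)).exp
    convert! h2.mul (h1.const_mul b) using 1
    have : Real.exp (-2 * l * t) * Real.exp (2 * l * t) = 1 := by
      rw [← Real.exp_add]; simp
    simp only [W]
    linear_combination -(b * u₀ t) * this
  have hWc : Continuous W := continuous_iff_continuousAt.2 fun t => (hWd t).continuousAt
  have hw₀ : Continuous w₀ := by
    have : w₀ = fun t => W (max t 0) := funext fun t => hW _ (le_max_right _ _)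
    rw [this]
    exact hWc.comp (by fun_prop)
  let U : ℝ → ℝ := fun t => 1 + b * ∫ s in (0 : ℝ)..t, w₀ s
  have hU : ∀ t, 0 ≤ t → u t = U t := by
    intro t ht
    rw [hu t ht]
    simp only [U]
    congr 2
    refine intervalIntegral.integral_congr fun s hs => ?_
    rw [uIcc_of_le ht] at hs
    simp only [w₀, max_eq_left hs.1]
  have hUd : ∀ t, HasDerivAt U (b * w₀ t) t := fun t =>
    ((hw₀.integral_hasStrictDerivAt 0 t).hasDerivAt.const_mul b).const_add 1
  -- These r are the eigenvalues of the system, and b u + r w is the combination satisfying p' = r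
  -- p.
  have hinv : ∀ r, r ^ 2 + 2 * l * r = b ^ 2 → b * u t + r * w t = b * Real.exp (r * t) := by
    intro r hr
    let p : ℝ → ℝ := fun t => (b * U t + r * W t) * Real.exp (-r * t)
    have hpd : ∀ s, HasDerivAt p ((b * (b * w₀ s) + r * (b * u₀ s - 2 * l * W s)) *
        Real.exp (-r * s) + (b * U s + r * W s) * (Real.exp (-r * s) * (-r))) s := by
      intro s
      have h2 : HasDerivAt (fun t => Real.exp (-r * t)) (Real.exp (-r * s) * (-r)) s := by
        simpa using ((hasDerivAt_id s).const_mul (-r)).exp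
      exact (((hUd s).const_mul b).add ((hWd s).const_mul r)).mul h2
    have hpc : p t = p 0 := by
      refine constant_of_has_deriv_right_zero (a := 0) (b := t)
        (continuous_iff_continuousAt.2 fun s => (hpd s).continuousAt).continuousOn
        (fun s hs => ?_) t ⟨ht, le_rfl⟩
      convert! (hpd s).hasDerivWithinAt using 1
      have e1 : w₀ s = W s := by simp only [w₀, max_eq_left hs.1, hW s hs.1]
      have e2 : u₀ s = U s := by simp only [u₀, max_eq_left hs.1, hU s hs.1]
      rw [e1, e2]
      linear_combination (W s * Real.exp (-r * s)) * hr
    have hp0 : p 0 = b := by simp [p, U, W]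
    have he : Real.exp (-r * t) * Real.exp (r * t) = 1 := by rw [← Real.exp_add]; simp
    rw [hU t ht, hW t ht]
    have : (b * U t + r * W t) * Real.exp (-r * t) = b := hpc.trans hp0
    linear_combination Real.exp (r * t) * this - (b * U t + r * W t) * he
  have hE : ∀ x, Real.exp (-l * t) * Real.exp x = Real.exp ((-l * t) + x) :=
    fun x => (Real.exp_add _ _).symm
  rcases eq_or_ne b 0 with rfl | hb
  · have hκl : κ = l := by rw [hκ]; simp [Real.sqrt_sq hl.le]
    rw [hκl, div_self hl.ne', one_mul, Real.cosh_add_sinh, hE, hu t ht]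
    simp
  · have h1 := hinv (-l + κ) (by linear_combination hκ2)
    have h2 := hinv (-l - κ) (by linear_combination hκ2)
    have e1 : Real.exp ((-l + κ) * t) = Real.exp (-l * t) * Real.exp (κ * t) := by
      rw [hE]; ring_nf
    have e2 : Real.exp ((-l - κ) * t) = Real.exp (-l * t) * Real.exp (-(κ * t)) := by
      rw [hE]; ring_nf
    rw [e1] at h1
    rw [e2] at h2
    rw [Real.cosh_eq, Real.sinh_eq]
    have key : κ * u t = Real.exp (-l * t) * (κ * ((Real.exp (κ * t) + Real.exp (-(κ * t))) / 2) +
        l * ((Real.exp (κ * t) - Real.exp (-(κ * t))) / 2)) :=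
      -- This combination of the relations for r = -l ± κ eliminates w; cancelling b is why b = 0 is
      -- separate.
      mul_left_cancel₀ hb (by linear_combination ((l + κ) * h1 - (l - κ) * h2) / 2)
    refine mul_left_cancel₀ hκpos.ne' ?_
    rw [key, mul_left_comm κ, mul_add κ, ← mul_assoc κ (l / κ), mul_div_cancel₀ _ hκpos.ne']

namespace IsRegularPoissonProcess

lemma integral_cosh_displacement [IsProbabilityMeasure μ]
    (hN : IsRegularPoissonProcess lam N μ) (hlam : 0 < lam) (b : ℝ) {t : ℝ} (ht : 0 ≤ t) :
    ∫ ω, Real.cosh (b * displacement N t ω) ∂μ =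
      Real.exp (-lam * t) * (Real.cosh (√(lam ^ 2 + b ^ 2) * t) +
        lam / √(lam ^ 2 + b ^ 2) * Real.sinh (√(lam ^ 2 + b ^ 2) * t)) := by
  have hcosh : ∀ y, HasDerivAt (fun y => Real.cosh (b * y)) (b * Real.sinh (b * y)) y := by
    intro y
    simpa [mul_comm] using ((hasDerivAt_id y).const_mul b).cosh
  have hsinh : ∀ y, HasDerivAt (fun y => Real.sinh (b * y)) (b * Real.cosh (b * y)) y := by
    intro y
    simpa [mul_comm] using ((hasDerivAt_id y).const_mul b).sinh
  have hcs : Continuous fun y => Real.sinh (b * y) := by fun_prop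
  have hcc : Continuous fun y => Real.cosh (b * y) := by fun_prop
  refine eq_exp_mul_cosh_add_sinh_of_integral_eq
    (u := fun t => ∫ ω, Real.cosh (b * displacement N t ω) ∂μ)
    (w := fun t => ∫ ω, parity N t ω * Real.sinh (b * displacement N t ω) ∂μ)
    (by exact_mod_cast hlam) (fun x y => hN.intervalIntegrable_integral_parity_mul hcs x y)
    (fun t ht => ?_) (fun t ht => ?_) ht
  · have h := hN.integral_mul_comp_displacement hcosh (by fun_prop)
      (measurable_const (a := (1 : ℝ))) (by simp) ht
    simp only [one_mul] at h
    rw [h, ← intervalIntegral.integral_const_mul]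
    simp only [mul_zero, Real.cosh_zero, integral_const, probReal_univ, smul_eq_mul,
      mul_one]
    congr 1
    refine intervalIntegral.integral_congr fun s _ => ?_
    rw [← integral_const_mul]
    exact integral_congr_ae (.of_forall fun ω => by ring)
  -- With the terminal parity as weight, the integrand contains the product of parities at t and s,
  -- whose expectation factors out the exponential kernel.
  · have h := hN.integral_mul_comp_displacement hsinh (by fun_prop)
      (hN.measurable_parity t) (fun ω => (abs_parity t ω).le) ht
    rw [h, ← intervalIntegral.integral_const_mul]
    simp only [mul_zero, Real.sinh_zero, zero_mul, zero_add]
    refine intervalIntegral.integral_congr fun s hs => ?_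
    rw [uIcc_of_le ht] at hs
    rw [← hN.integral_parity_mul_parity_mul_comp hs.1 hs.2 hcc, ← integral_const_mul]
    exact integral_congr_ae (.of_forall fun ω => by ring)

end IsRegularPoissonProcess

end Poisson

/-! ### Power series of the moment generating function -/

open scoped Nat

/-- A Beta integral, by induction on k with m free: the extra factor 1 - u² splits the integral into
those for m and m + 1. -/
lemma integral_pow_mul_one_sub_sq_pow (k m : ℕ) :
    ∫ u in (-1 : ℝ)..1, u ^ (2 * m) * (1 - u ^ 2) ^ k =
      (2 : ℝ) ^ (2 * k + 1) * k ! * (2 * m)! * (k + m)! / (m ! * (2 * k + 2 * m + 1)!) := by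
  induction k generalizing m with
  | zero =>
    have h0 : (-1 : ℝ) ^ (2 * m + 1) = -1 := by simp [pow_succ]
    simp only [pow_zero, mul_one, mul_zero, zero_add, Nat.factorial_zero, Nat.cast_one,
      integral_pow, Nat.factorial_succ, h0, one_pow]
    have h1 : (m ! : ℝ) ≠ 0 := by positivity
    have h2 : ((2 * m)! : ℝ) ≠ 0 := by positivity
    push_cast
    field_simp
    norm_num
  | succ k ih =>
    have h : ∫ u in (-1 : ℝ)..1, u ^ (2 * m) * (1 - u ^ 2) ^ (k + 1) =
        (∫ u in (-1 : ℝ)..1, u ^ (2 * m) * (1 - u ^ 2) ^ k) -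
          ∫ u in (-1 : ℝ)..1, u ^ (2 * (m + 1)) * (1 - u ^ 2) ^ k := by
      rw [← intervalIntegral.integral_sub
        (Continuous.intervalIntegrable (by fun_prop) _ _)
        (Continuous.intervalIntegrable (by fun_prop) _ _)]
      congr 1
      funext u
      ring
    rw [h, ih, ih]
    have e1 : (2 * (m + 1))! = (2 * m + 2) * ((2 * m + 1) * (2 * m)!) := by
      rw [show 2 * (m + 1) = 2 * m + 1 + 1 by ring, Nat.factorial_succ, Nat.factorial_succ]
    have e2 : (2 * k + 2 * (m + 1) + 1)! =
        (2 * k + 2 * m + 3) * ((2 * k + 2 * m + 2) * (2 * k + 2 * m + 1)!) := by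
      rw [show 2 * k + 2 * (m + 1) + 1 = 2 * k + 2 * m + 1 + 1 + 1 by ring, Nat.factorial_succ,
        Nat.factorial_succ]
    have e3 : (2 * (k + 1) + 2 * m + 1)! =
        (2 * k + 2 * m + 3) * ((2 * k + 2 * m + 2) * (2 * k + 2 * m + 1)!) := by
      rw [← e2]; congr 1; ring
    have e4 : (k + (m + 1))! = (k + m + 1) * (k + m)! := by
      rw [← add_assoc, Nat.factorial_succ]
    have e5 : (k + 1 + m)! = (k + m + 1) * (k + m)! := by
      rw [← e4]; congr 1; ring
    rw [e1, e2, e3, e4, e5, Nat.factorial_succ k, Nat.factorial_succ m]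
    have h1 : (m ! : ℝ) ≠ 0 := by positivity
    have h2 : ((2 * k + 2 * m + 1)! : ℝ) ≠ 0 := by positivity
    push_cast
    field_simp
    ring

/-- The weight is even, so the exponential may be replaced by cosh, whose series is integrated
termwise. -/
lemma hasSum_integral_one_sub_sq_pow_mul_exp (k : ℕ) (a : ℝ) :
    HasSum (fun m : ℕ => a ^ (2 * m) / (2 * m)! *
        ∫ u in (-1 : ℝ)..1, u ^ (2 * m) * (1 - u ^ 2) ^ k)
      (∫ u in (-1 : ℝ)..1, (1 - u ^ 2) ^ k * Real.exp (a * u)) := by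
  have hcosh : ∫ u in (-1 : ℝ)..1, (1 - u ^ 2) ^ k * Real.exp (a * u) =
      ∫ u in (-1 : ℝ)..1, (1 - u ^ 2) ^ k * Real.cosh (a * u) := by
    have hneg : ∫ u in (-1 : ℝ)..1, (1 - u ^ 2) ^ k * Real.exp (-(a * u)) =
        ∫ u in (-1 : ℝ)..1, (1 - u ^ 2) ^ k * Real.exp (a * u) := by
      have := intervalIntegral.integral_comp_neg (a := (-1 : ℝ)) (b := 1)
        (fun u => (1 - u ^ 2) ^ k * Real.exp (a * u))
      simpa using this
    have hadd : (∫ u in (-1 : ℝ)..1, (1 - u ^ 2) ^ k * Real.exp (a * u)) +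
        ∫ u in (-1 : ℝ)..1, (1 - u ^ 2) ^ k * Real.exp (-(a * u)) =
        2 * ∫ u in (-1 : ℝ)..1, (1 - u ^ 2) ^ k * Real.cosh (a * u) := by
      rw [← intervalIntegral.integral_add (Continuous.intervalIntegrable (by fun_prop) _ _)
        (Continuous.intervalIntegrable (by fun_prop) _ _), ← intervalIntegral.integral_const_mul]
      congr 1
      funext u
      rw [Real.cosh_eq]
      ring
    linarith
  rw [hcosh]
  simp_rw [← intervalIntegral.integral_const_mul]
  refine intervalIntegral.hasSum_integral_of_dominated_convergence
    (fun m _ => |a| ^ (2 * m) / (2 * m)!) (fun m => ?_) (fun m => ?_) ?_ ?_ ?_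
  · exact Continuous.aestronglyMeasurable (by fun_prop)
  · refine .of_forall fun u hu => ?_
    rw [uIoc_of_le (by norm_num)] at hu
    have hu2 : u ^ 2 ≤ 1 := by nlinarith [hu.1, hu.2]
    have h1 : ‖u ^ (2 * m) * (1 - u ^ 2) ^ k‖ ≤ 1 := by
      rw [pow_mul, Real.norm_of_nonneg
        (mul_nonneg (by positivity) (pow_nonneg (by linarith) _))]
      exact mul_le_one₀ (pow_le_one₀ (by positivity) hu2) (pow_nonneg (by linarith) _)
        (pow_le_one₀ (by linarith) (by linarith [sq_nonneg u]))
    rw [norm_mul]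
    refine (mul_le_of_le_one_right (norm_nonneg _) h1).trans_eq ?_
    simp
  · exact .of_forall fun u _ => (Real.hasSum_cosh |a|).summable
  · exact intervalIntegrable_const
  · refine .of_forall fun u _ => ?_
    convert! (Real.hasSum_cosh (a * u)).mul_left ((1 - u ^ 2) ^ k) using 1
    funext m
    rw [mul_pow]
    ring

/-- Binomial expansion along antidiagonals; nonnegativity justifies regrouping into a double series.
-/
lemma hasSum_prod_choose_of_hasSum_add_pow {c : ℕ → ℝ} (hc : ∀ n, 0 ≤ c n) {x y S : ℝ}
    (hx : 0 ≤ x) (hy : 0 ≤ y) (h : HasSum (fun n => c n * (x + y) ^ n) S) :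
    HasSum (fun p : ℕ × ℕ => c (p.1 + p.2) * ((p.1 + p.2).choose p.1 * (x ^ p.1 * y ^ p.2))) S := by
  set f : ℕ × ℕ → ℝ := fun p => c (p.1 + p.2) * ((p.1 + p.2).choose p.1 * (x ^ p.1 * y ^ p.2))
  have hf : ∀ p, 0 ≤ f p := fun p => mul_nonneg (hc _) (by positivity)
  have hfib : ∀ n, HasSum (fun p : Finset.HasAntidiagonal.antidiagonal n => f p.1) (c n * (x + y) ^ n) := by
    intro n
    have : c n * (x + y) ^ n = ∑ p ∈ Finset.HasAntidiagonal.antidiagonal n, f p := by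
      rw [(Commute.all x y).add_pow', Finset.mul_sum]
      refine Finset.sum_congr rfl fun p hp => ?_
      rw [Finset.HasAntidiagonal.mem_antidiagonal] at hp
      simp only [f, hp, nsmul_eq_mul]
    rw [this, ← Finset.sum_coe_sort]
    exact hasSum_fintype _
  rw [← Finset.HasAntidiagonal.sigmaAntidiagonalEquivProd.hasSum_iff]
  have hsum : Summable (f ∘ Finset.HasAntidiagonal.sigmaAntidiagonalEquivProd) := by
    refine (summable_sigma_of_nonneg fun p => hf _).2 ⟨fun n => (hfib n).summable, ?_⟩
    refine h.summable.congr fun n => ?_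
    exact (hfib n).tsum_eq.symm
  have := hsum.hasSum.sigma (fun n => hfib n)
  rw [h.unique this]
  exact hsum.hasSum

/-- Coefficient of `(1 - u ^ 2) ^ k` in the density of the telegraph process. -/
noncomputable def telegraphWeight (T : ℝ) (k : ℕ) : ℝ :=
  1 / (k ! : ℝ) ^ 2 * (T / 2) ^ (2 * k) * (1 + T / (2 * k + 2))

lemma telegraphWeight_nonneg {T : ℝ} (hT : 0 ≤ T) (k : ℕ) : 0 ≤ telegraphWeight T k := by
  unfold telegraphWeight
  positivity

lemma summable_telegraphWeight {T : ℝ} (hT : 0 ≤ T) : Summable (telegraphWeight T) := by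
  refine Summable.of_nonneg_of_le (telegraphWeight_nonneg hT) (fun k => ?_)
    ((Real.summable_pow_div_factorial ((T / 2) ^ 2)).mul_right (1 + T))
  unfold telegraphWeight
  have hk : (1 : ℝ) ≤ k ! := by exact_mod_cast Nat.one_le_iff_ne_zero.2 (Nat.factorial_ne_zero k)
  rw [pow_mul]
  refine mul_le_mul ?_ ?_ (by positivity) (by positivity)
  · rw [one_div, mul_comm, ← div_eq_mul_inv]
    exact div_le_div_of_nonneg_left (by positivity) (by positivity) (by nlinarith)
  · have : T / (2 * k + 2) ≤ T := div_le_self hT (by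
      have : (0 : ℝ) ≤ k := by positivity
      linarith)
    linarith

/-- The k-th term collects T^(2k+1) from the sinh series and T^(2k+2) from the cosh series: the two
summands of 1 + T/(2k+2) in the weight. -/
lemma hasSum_telegraphWeight_mul_integral {T : ℝ} (hT : 0 < T) (a : ℝ) :
    HasSum (fun k => T / 2 * telegraphWeight T k *
        ∫ u in (-1 : ℝ)..1, (1 - u ^ 2) ^ k * Real.exp (a * u))
      (Real.cosh (√(T ^ 2 + a ^ 2)) + T / √(T ^ 2 + a ^ 2) * Real.sinh (√(T ^ 2 + a ^ 2)) -
        Real.cosh a) := by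
  set κ := √(T ^ 2 + a ^ 2)
  have hκ : 0 < κ := Real.sqrt_pos.2 (by positivity)
  have hκ2 : κ ^ 2 = T ^ 2 + a ^ 2 := Real.sq_sqrt (by positivity)
  have h1 : HasSum (fun n : ℕ => 1 / ((2 * n)! : ℝ) * (T ^ 2 + a ^ 2) ^ n) (Real.cosh κ) := by
    convert! Real.hasSum_cosh κ using 1
    funext n
    rw [pow_mul, hκ2]
    ring
  have h2 : HasSum (fun n : ℕ => T / ((2 * n + 1)! : ℝ) * (T ^ 2 + a ^ 2) ^ n)
      (T / κ * Real.sinh κ) := by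
    convert! (Real.hasSum_sinh κ).mul_left (T / κ) using 1
    funext n
    rw [pow_succ κ, pow_mul κ, hκ2]
    field_simp
  have p1 := hasSum_prod_choose_of_hasSum_add_pow (c := fun n => 1 / ((2 * n)! : ℝ))
    (fun n => by positivity) (sq_nonneg T) (sq_nonneg a) h1
  have p2 := hasSum_prod_choose_of_hasSum_add_pow (c := fun n => T / ((2 * n + 1)! : ℝ))
    (fun n => by positivity) (sq_nonneg T) (sq_nonneg a) h2
  have q1 := p1.prod_fiberwise fun i => (p1.summable.prod_factor i).hasSum
  have q2 := p2.prod_fiberwise fun i => (p2.summable.prod_factor i).hasSum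
  -- Dropping row 0 of the cosh series, which is cosh a, pairs row k + 1 of cosh with row k of sinh.
  have q1' := (hasSum_nat_add_iff' 1).2 q1
  have q := q1'.add q2
  have hz : ∑' m : ℕ, 1 / ((2 * (0 + m))! : ℝ) *
      ((0 + m).choose 0 * ((T ^ 2) ^ 0 * (a ^ 2) ^ m)) = Real.cosh a := by
    rw [← (Real.hasSum_cosh a).tsum_eq]
    refine tsum_congr fun m => ?_
    simp [pow_mul]
    ring
  simp only [Finset.sum_range_one] at q
  rw [hz, sub_add_eq_add_sub] at q
  convert! q using 1
  funext k
  refine HasSum.unique ?_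
    ((p1.summable.prod_factor (k + 1)).hasSum.add (p2.summable.prod_factor k).hasSum)
  convert! (hasSum_integral_one_sub_sq_pow_mul_exp k a).mul_left
    (T / 2 * telegraphWeight T k) using 1
  funext m
  rw [integral_pow_mul_one_sub_sq_pow, Nat.cast_add_choose, Nat.cast_add_choose, telegraphWeight]
  have e1 : (2 * (k + 1 + m))! = (2 * k + 2 * m + 2) * (2 * k + 2 * m + 1)! := by
    rw [show 2 * (k + 1 + m) = 2 * k + 2 * m + 1 + 1 by ring, Nat.factorial_succ]
  have e2 : (2 * (k + m) + 1)! = (2 * k + 2 * m + 1)! := by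
    congr 1; ring
  have e3 : (k + 1 + m)! = (k + m + 1) * (k + m)! := by
    rw [show k + 1 + m = k + m + 1 by ring, Nat.factorial_succ]
  rw [e1, e2, e3, Nat.factorial_succ k]
  have h1 : (m ! : ℝ) ≠ 0 := by positivity
  have h2 : (k ! : ℝ) ≠ 0 := by positivity
  have h3 : ((2 * k + 2 * m + 1)! : ℝ) ≠ 0 := by positivity
  have h4 : ((2 * m)! : ℝ) ≠ 0 := by positivity
  push_cast
  rw [← pow_mul, ← pow_mul, ← pow_mul, div_pow]
  field_simp
  ring

/-! ### The terminating hypergeometric function -/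

/-- The ratio (1/2)_n / (3/2)_n is 1/(2n+1), the integral of v^(2n), and (-k)_n / n! is a signed
binomial coefficient, so the series is a binomial expansion integrated termwise. -/
lemma ordinaryHypergeometric_neg_nat_half (k : ℕ) (y : ℝ) :
    ₂F₁ (-(k : ℝ)) (1 / 2 : ℝ) (3 / 2 : ℝ) y = ∫ v in (0 : ℝ)..1, (1 - y * v ^ 2) ^ k := by
  have hpoch : ∀ n : ℕ, (ascPochhammer ℝ n).eval (1 / 2 : ℝ) * (2 * n + 1) =
      (ascPochhammer ℝ n).eval (3 / 2 : ℝ) := by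
    intro n
    induction n with
    | zero => simp
    | succ n ih =>
      rw [ascPochhammer_succ_eval, ascPochhammer_succ_eval, ← ih]
      push_cast
      ring
  have hpos : ∀ n : ℕ, 0 < (ascPochhammer ℝ n).eval (1 / 2 : ℝ) :=
    fun n => ascPochhammer_pos n _ (by norm_num)
  have hterm : ∀ n : ℕ, ((n ! : ℝ)⁻¹ * (ascPochhammer ℝ n).eval (-(k : ℝ)) *
      (ascPochhammer ℝ n).eval (1 / 2 : ℝ) * ((ascPochhammer ℝ n).eval (3 / 2 : ℝ))⁻¹) • y ^ n =
      k.choose n * (-y) ^ n / (2 * n + 1) := by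
    intro n
    rw [← hpoch, ascPochhammer_eval_neg_eq_descPochhammer, descPochhammer_eval_eq_descFactorial,
      Nat.descFactorial_eq_factorial_mul_choose, neg_pow y, smul_eq_mul]
    have := (hpos n).ne'
    have h2 : (n ! : ℝ) ≠ 0 := by positivity
    push_cast
    field_simp
  rw [ordinaryHypergeometric_eq_tsum]
  simp only [hterm]
  rw [tsum_eq_sum (s := Finset.range (k + 1))]
  · simp_rw [sub_eq_add_neg, add_comm (1 : ℝ), add_pow, one_pow, mul_one]
    rw [intervalIntegral.integral_finsetSum fun n _ =>
      Continuous.intervalIntegrable (by fun_prop) _ _]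
    refine Finset.sum_congr rfl fun n _ => ?_
    have : ∀ v : ℝ, (-(y * v ^ 2)) ^ n * (k.choose n : ℝ) =
        (k.choose n * (-y) ^ n) * v ^ (2 * n) := by
      intro v
      rw [← neg_mul, mul_pow, ← pow_mul]
      ring
    simp_rw [this]
    rw [intervalIntegral.integral_const_mul, integral_pow]
    simp
    ring
  · intro n hn
    rw [Finset.mem_range, not_lt] at hn
    rw [Nat.choose_eq_zero_of_lt (by omega)]
    simp

lemma abs_ordinaryHypergeometric_neg_nat_half_le (k : ℕ) {y : ℝ} (hy0 : 0 ≤ y) (hy1 : y ≤ 1) :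
    |₂F₁ (-(k : ℝ)) (1 / 2 : ℝ) (3 / 2 : ℝ) y| ≤ 1 := by
  rw [ordinaryHypergeometric_neg_nat_half]
  suffices h : ∀ v ∈ uIoc (0 : ℝ) 1, ‖(1 - y * v ^ 2) ^ k‖ ≤ 1 by
    simpa using intervalIntegral.norm_integral_le_of_norm_le_const h
  intro v hv
  rw [uIoc_of_le zero_le_one] at hv
  have h : y * v ^ 2 ≤ 1 := mul_le_one₀ hy1 (by positivity) (pow_le_one₀ hv.1.le hv.2)
  rw [Real.norm_of_nonneg (pow_nonneg (by linarith) _)]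
  exact pow_le_one₀ (by linarith) (by nlinarith [sq_nonneg v])

lemma mul_ordinaryHypergeometric_neg_nat_half (k : ℕ) (z : ℝ) :
    z * ₂F₁ (-(k : ℝ)) (1 / 2 : ℝ) (3 / 2 : ℝ) (z ^ 2) = ∫ u in (0 : ℝ)..z, (1 - u ^ 2) ^ k := by
  rw [ordinaryHypergeometric_neg_nat_half]
  have := intervalIntegral.mul_integral_comp_mul_left (a := (0 : ℝ)) (b := 1) (c := z)
    (f := fun u => (1 - u ^ 2) ^ k)
  simpa [mul_pow] using this

/-! ### The candidate law: transform and distribution function -/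

/-- Measure on `ℝ` with density `(1 - u ^ 2) ^ k` on `(-1, 1]`. -/
noncomputable def oneSubSqPowMeasure (k : ℕ) : Measure ℝ :=
  (volume.restrict (Ioc (-1 : ℝ) 1)).withDensity fun u => ENNReal.ofReal ((1 - u ^ 2) ^ k)

/-- Law of the telegraph process at time `t`, rescaled to `[-1, 1]`, with `T = lam * t`. -/
noncomputable def telegraphMeasure (T : ℝ) : Measure ℝ :=
  ENNReal.ofReal (Real.exp (-T)) • (ENNReal.ofReal (1 / 2) • (Measure.dirac 1 + Measure.dirac (-1)) +
    Measure.sum fun k => ENNReal.ofReal (T / 2 * telegraphWeight T k) • oneSubSqPowMeasure k)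

lemma one_sub_sq_pow_nonneg {u : ℝ} (hu : u ∈ Icc (-1 : ℝ) 1) (k : ℕ) : 0 ≤ (1 - u ^ 2) ^ k :=
  pow_nonneg (by nlinarith [hu.1, hu.2]) k

lemma lintegral_oneSubSqPowMeasure (k : ℕ) {g : ℝ → ℝ} (hg : Continuous g) (hg0 : ∀ u, 0 ≤ g u) :
    ∫⁻ u, ENNReal.ofReal (g u) ∂(oneSubSqPowMeasure k) =
      ENNReal.ofReal (∫ u in (-1 : ℝ)..1, (1 - u ^ 2) ^ k * g u) := by
  have hc : Continuous fun u : ℝ => (1 - u ^ 2) ^ k * g u := by fun_prop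
  rw [oneSubSqPowMeasure, lintegral_withDensity_eq_lintegral_mul _ (by fun_prop)
    (hg.measurable.ennreal_ofReal), intervalIntegral.integral_of_le (by norm_num),
    ofReal_integral_eq_lintegral_ofReal (hc.integrableOn_Ioc)
      ((ae_restrict_iff' measurableSet_Ioc).2 (.of_forall fun u hu =>
        mul_nonneg (one_sub_sq_pow_nonneg (Ioc_subset_Icc_self hu) k) (hg0 u)))]
  refine setLIntegral_congr_fun measurableSet_Ioc fun u hu => ?_
  simp only [Pi.mul_apply]
  rw [ENNReal.ofReal_mul (one_sub_sq_pow_nonneg (Ioc_subset_Icc_self hu) k)]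

lemma oneSubSqPowMeasure_Iio (k : ℕ) {z : ℝ} (hz0 : -1 < z) (hz1 : z ≤ 1) :
    oneSubSqPowMeasure k (Iio z) = ENNReal.ofReal (∫ u in (-1 : ℝ)..z, (1 - u ^ 2) ^ k) := by
  have hc : Continuous fun u : ℝ => (1 - u ^ 2) ^ k := by fun_prop
  have hset : Iio z ∩ Ioc (-1) 1 = Ioo (-1) z := by
    ext u
    simp only [mem_inter_iff, mem_Iio, mem_Ioc, mem_Ioo]
    constructor
    · rintro ⟨h1, h2, h3⟩
      exact ⟨h2, h1⟩
    · rintro ⟨h1, h2⟩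
      exact ⟨h2, h1, by linarith⟩
  rw [oneSubSqPowMeasure, withDensity_apply _ measurableSet_Iio,
    Measure.restrict_restrict measurableSet_Iio, hset, intervalIntegral.integral_of_le hz0.le,
    integral_Ioc_eq_integral_Ioo, ofReal_integral_eq_lintegral_ofReal
      (hc.integrableOn_Ioc.mono_set Ioo_subset_Ioc_self)
      ((ae_restrict_iff' measurableSet_Ioo).2 (.of_forall fun u hu =>
        one_sub_sq_pow_nonneg ⟨hu.1.le, (hu.2.trans_le hz1).le⟩ k))]

lemma integral_one_sub_sq_pow_nonneg (k : ℕ) {z : ℝ} (hz0 : -1 < z) (hz1 : z ≤ 1) :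
    0 ≤ ∫ u in (-1 : ℝ)..z, (1 - u ^ 2) ^ k :=
  intervalIntegral.integral_nonneg hz0.le fun _ hu =>
    one_sub_sq_pow_nonneg ⟨hu.1, hu.2.trans hz1⟩ k

/-- The atoms contribute exactly the cosh a missing from the series. The case a = 0 yields total
mass one. -/
lemma lintegral_exp_telegraphMeasure {T : ℝ} (hT : 0 < T) (a : ℝ) :
    ∫⁻ u, ENNReal.ofReal (Real.exp (a * u)) ∂(telegraphMeasure T) =
      ENNReal.ofReal (Real.exp (-T) * (Real.cosh (√(T ^ 2 + a ^ 2)) +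
        T / √(T ^ 2 + a ^ 2) * Real.sinh (√(T ^ 2 + a ^ 2)))) := by
  have hs := hasSum_telegraphWeight_mul_integral hT a
  have hw : ∀ k, 0 ≤ T / 2 * telegraphWeight T k := fun k =>
    mul_nonneg (by positivity) (telegraphWeight_nonneg hT.le k)
  have hJ : ∀ k : ℕ, 0 ≤ ∫ u in (-1 : ℝ)..1, (1 - u ^ 2) ^ k * Real.exp (a * u) := fun k =>
    intervalIntegral.integral_nonneg (by norm_num) fun u hu =>
      mul_nonneg (one_sub_sq_pow_nonneg hu k) (Real.exp_nonneg _)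
  have hsum : ∑' k, ENNReal.ofReal (T / 2 * telegraphWeight T k) *
      ENNReal.ofReal (∫ u in (-1 : ℝ)..1, (1 - u ^ 2) ^ k * Real.exp (a * u)) =
      ENNReal.ofReal (Real.cosh (√(T ^ 2 + a ^ 2)) +
        T / √(T ^ 2 + a ^ 2) * Real.sinh (√(T ^ 2 + a ^ 2)) - Real.cosh a) := by
    rw [← hs.tsum_eq, ENNReal.ofReal_tsum_of_nonneg (fun k => mul_nonneg (hw k) (hJ k)) hs.summable]
    exact tsum_congr fun k => (ENNReal.ofReal_mul (hw k)).symm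
  have hpos := hs.nonneg fun k => mul_nonneg (hw k) (hJ k)
  rw [telegraphMeasure, lintegral_smul_measure, lintegral_add_measure, lintegral_smul_measure,
    lintegral_add_measure, lintegral_sum_measure]
  simp_rw [lintegral_smul_measure, lintegral_oneSubSqPowMeasure _
    (show Continuous fun u : ℝ => Real.exp (a * u) by fun_prop) (fun u => Real.exp_nonneg _),
    lintegral_dirac, smul_eq_mul]
  rw [hsum, ← ENNReal.ofReal_add (Real.exp_nonneg _) (Real.exp_nonneg _),
    ← ENNReal.ofReal_mul (by norm_num), ← ENNReal.ofReal_add (by positivity) hpos,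
    ← ENNReal.ofReal_mul (Real.exp_nonneg _)]
  congr 2
  rw [Real.cosh_eq a]
  ring_nf

lemma isProbabilityMeasure_telegraphMeasure {T : ℝ} (hT : 0 < T) :
    IsProbabilityMeasure (telegraphMeasure T) := by
  have h := lintegral_exp_telegraphMeasure hT 0
  have h2 : √(T ^ 2 + 0 ^ 2) = T := by simp [Real.sqrt_sq hT.le]
  rw [h2, div_self hT.ne', one_mul, Real.cosh_add_sinh, ← Real.exp_add] at h
  exact ⟨by simpa using h⟩

lemma mgf_telegraphMeasure {T : ℝ} (hT : 0 < T) (a : ℝ) :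
    mgf id (telegraphMeasure T) a = Real.exp (-T) * (Real.cosh (√(T ^ 2 + a ^ 2)) +
        T / √(T ^ 2 + a ^ 2) * Real.sinh (√(T ^ 2 + a ^ 2))) := by
  rw [mgf, integral_eq_lintegral_of_nonneg_ae (.of_forall fun _ => Real.exp_nonneg _)
    (by fun_prop)]
  simp only [id]
  rw [lintegral_exp_telegraphMeasure hT a, ENNReal.toReal_ofReal]
  have := Real.cosh_pos (√(T ^ 2 + a ^ 2))
  have := Real.sinh_nonneg_iff.2 (Real.sqrt_nonneg (T ^ 2 + a ^ 2))
  positivity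

lemma telegraphMeasure_real_Iio {T : ℝ} (hT : 0 < T) {z : ℝ} (hz0 : -1 < z) (hz1 : z ≤ 1) :
    Summable (fun k => telegraphWeight T k *
      ₂F₁ (-(k : ℝ)) (1 / 2 : ℝ) (3 / 2 : ℝ) (z ^ 2)) ∧
    (telegraphMeasure T).real (Iio z) = 1 / 2 + T / 2 * z * Real.exp (-T) *
      ∑' k, telegraphWeight T k * ₂F₁ (-(k : ℝ)) (1 / 2 : ℝ) (3 / 2 : ℝ) (z ^ 2) := by
  have hw : ∀ k, 0 ≤ T / 2 * telegraphWeight T k := fun k =>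
    mul_nonneg (by positivity) (telegraphWeight_nonneg hT.le k)
  have hF : Summable (fun k => telegraphWeight T k *
      ₂F₁ (-(k : ℝ)) (1 / 2 : ℝ) (3 / 2 : ℝ) (z ^ 2)) := by
    refine (summable_telegraphWeight hT.le).of_norm_bounded fun k => ?_
    rw [norm_mul, Real.norm_of_nonneg (telegraphWeight_nonneg hT.le k)]
    exact mul_le_of_le_one_right (telegraphWeight_nonneg hT.le k)
      (abs_ordinaryHypergeometric_neg_nat_half_le k (sq_nonneg z) (by nlinarith))
  refine ⟨hF, ?_⟩
  -- The mass of the continuous part before the factor e^{-T}; by symmetry half of it lies below 0.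
  have htot : HasSum (fun k => T / 2 * telegraphWeight T k * ∫ u in (-1 : ℝ)..1, (1 - u ^ 2) ^ k)
      (Real.exp T - 1) := by
    have h := hasSum_telegraphWeight_mul_integral hT 0
    have h2 : √(T ^ 2 + 0 ^ 2) = T := by simp [Real.sqrt_sq hT.le]
    rw [h2, div_self hT.ne', one_mul, Real.cosh_add_sinh] at h
    simpa using h
  have hhalf : ∀ k : ℕ, ∫ u in (-1 : ℝ)..0, (1 - u ^ 2) ^ k =
      (∫ u in (-1 : ℝ)..1, (1 - u ^ 2) ^ k) / 2 := by
    intro k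
    have hc : Continuous fun u : ℝ => (1 - u ^ 2) ^ k := by fun_prop
    have h1 := intervalIntegral.integral_add_adjacent_intervals
      (hc.intervalIntegrable (μ := volume) (-1) 0) (hc.intervalIntegrable 0 1)
    have h2 := intervalIntegral.integral_comp_neg (a := (-1 : ℝ)) (b := 0)
        (fun u => (1 - u ^ 2) ^ k)
    simp only [neg_sq, neg_zero, neg_neg] at h2
    linarith
  have hsplit : ∀ k : ℕ, ∫ u in (-1 : ℝ)..z, (1 - u ^ 2) ^ k =
      (∫ u in (-1 : ℝ)..1, (1 - u ^ 2) ^ k) / 2 +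
        z * ₂F₁ (-(k : ℝ)) (1 / 2 : ℝ) (3 / 2 : ℝ) (z ^ 2) := by
    intro k
    have hc : Continuous fun u : ℝ => (1 - u ^ 2) ^ k := by fun_prop
    rw [mul_ordinaryHypergeometric_neg_nat_half, ← hhalf]
    exact (intervalIntegral.integral_add_adjacent_intervals
      (hc.intervalIntegrable _ _) (hc.intervalIntegrable _ _)).symm
  have hsum : HasSum (fun k => T / 2 * telegraphWeight T k * ∫ u in (-1 : ℝ)..z, (1 - u ^ 2) ^ k)
      ((Real.exp T - 1) * (1 / 2) + T / 2 * z * ∑' k, telegraphWeight T k *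
        ₂F₁ (-(k : ℝ)) (1 / 2 : ℝ) (3 / 2 : ℝ) (z ^ 2)) := by
    convert! (htot.mul_right (1 / 2)).add (hF.hasSum.mul_left (T / 2 * z)) using 1
    funext k
    rw [hsplit]
    ring
  have hI := fun k => integral_one_sub_sq_pow_nonneg k hz0 hz1
  have hval : telegraphMeasure T (Iio z) = ENNReal.ofReal (Real.exp (-T) * (1 / 2 +
      ((Real.exp T - 1) * (1 / 2) + T / 2 * z * ∑' k, telegraphWeight T k *
        ₂F₁ (-(k : ℝ)) (1 / 2 : ℝ) (3 / 2 : ℝ) (z ^ 2)))) := by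
    have hpos := hsum.nonneg fun k => mul_nonneg (hw k) (hI k)
    rw [ENNReal.ofReal_mul (Real.exp_nonneg _), ENNReal.ofReal_add (by norm_num) hpos,
      ← hsum.tsum_eq,
      ENNReal.ofReal_tsum_of_nonneg (fun k => mul_nonneg (hw k) (hI k)) hsum.summable]
    simp_rw [fun k => ENNReal.ofReal_mul (q := ∫ u in (-1 : ℝ)..z, (1 - u ^ 2) ^ k) (hw k),
      ← fun k => oneSubSqPowMeasure_Iio k hz0 hz1]
    rw [telegraphMeasure, Measure.smul_apply, Measure.add_apply, Measure.smul_apply,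
      Measure.add_apply, Measure.sum_apply _ measurableSet_Iio,
      Measure.dirac_apply' _ measurableSet_Iio, Measure.dirac_apply' _ measurableSet_Iio]
    -- Only the atom at -1 lies in `Iio z`; the one at 1 is excluded even when z = 1.
    simp [hz0, hz1]
  have he : Real.exp (-T) * Real.exp T = 1 := by rw [← Real.exp_add]; simp
  rw [measureReal_def, hval, ENNReal.toReal_ofReal]
  · linear_combination (1 / 2) * he
  · exact mul_nonneg (Real.exp_nonneg _) (add_nonneg (by norm_num)
      (hsum.nonneg fun k => mul_nonneg (hw k) (hI k)))

/-! ### Identification of the law -/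

/-- A bounded random variable is determined in law by its moment generating function. -/
lemma map_eq_of_mgf_eq_of_bounded {Ω : Type*} {mΩ : MeasurableSpace Ω} {μ : Measure Ω}
    [IsProbabilityMeasure μ] {Z : Ω → ℝ} {C : ℝ} (hZ : AEMeasurable Z μ)
    (hZC : ∀ᵐ ω ∂μ, |Z ω| ≤ C) {ν : Measure ℝ} [IsFiniteMeasure ν]
    (h : mgf Z μ = mgf id ν) : μ.map Z = ν := by
  -- Finiteness at every real argument makes the strip of agreement of the complex transforms all of
  -- ℂ.
  have hset : integrableExpSet Z μ = univ := by
    refine eq_univ_of_forall fun a => ?_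
    refine Integrable.of_bound (by fun_prop) (Real.exp (|a| * C)) ?_
    filter_upwards [hZC] with ω hω
    rw [Real.norm_of_nonneg (Real.exp_nonneg _)]
    refine Real.exp_le_exp.2 ((le_abs_self _).trans ?_)
    rw [abs_mul]
    gcongr
  have hc := eqOn_complexMGF_of_mgf h
  rw [hset] at hc
  have hc' : complexMGF Z μ = complexMGF id ν := funext fun z => hc (by simp)
  simpa using Measure.ext_of_complexMGF_eq hZ aemeasurable_id hc'

section Direction

variable {Ω : Type*} {mΩ : MeasurableSpace Ω} {μ : Measure Ω}

lemma ae_direction [IsProbabilityMeasure μ] {D : Ω → ℝ} (hD : Measurable D)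
    (h1 : μ {ω | D ω = 1} = 1 / 2) (h2 : μ {ω | D ω = -1} = 1 / 2) :
    ∀ᵐ ω ∂μ, D ω = 1 ∨ D ω = -1 := by
  have hm1 : MeasurableSet {ω | D ω = 1} := hD (measurableSet_singleton 1)
  have hm2 : MeasurableSet {ω | D ω = -1} := hD (measurableSet_singleton (-1))
  have hdisj : Disjoint {ω | D ω = 1} {ω | D ω = -1} :=
    Set.disjoint_left.2 fun ω (ha : D ω = 1) (hb : D ω = -1) => by linarith
  have hu : μ ({ω | D ω = 1} ∪ {ω | D ω = -1}) = 1 := by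
    rw [measure_union hdisj hm2, h1, h2, ENNReal.add_halves]
  exact (prob_compl_eq_zero_iff (hm1.union hm2)).2 hu

lemma integral_direction [IsProbabilityMeasure μ] {D : Ω → ℝ} (hD : Measurable D)
    (h1 : μ {ω | D ω = 1} = 1 / 2) (h2 : μ {ω | D ω = -1} = 1 / 2) :
    ∫ ω, D ω ∂μ = 0 := by
  have hm1 : MeasurableSet {ω | D ω = 1} := hD (measurableSet_singleton 1)
  have hm2 : MeasurableSet {ω | D ω = -1} := hD (measurableSet_singleton (-1))
  have h : D =ᵐ[μ] fun ω => indicator {ω | D ω = 1} (fun _ => (1 : ℝ)) ω -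
      indicator {ω | D ω = -1} (fun _ => (1 : ℝ)) ω := by
    filter_upwards [ae_direction hD h1 h2] with ω hω
    rcases hω with hω | hω <;> simp [indicator, hω] <;> norm_num
  rw [integral_congr_ae h, integral_sub ((integrable_const _).indicator hm1)
    ((integrable_const _).indicator hm2), integral_indicator_const _ hm1,
    integral_indicator_const _ hm2, measureReal_def, measureReal_def, h1, h2, sub_self]

end Direction

namespace IsRegularPoissonProcess

variable {Ω : Type*} {mΩ : MeasurableSpace Ω} {μ : Measure Ω} {lam : ℝ≥0} {N : ℝ≥0 → Ω → ℕ}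

/-- For D = ±1, exp(D y) = cosh y + D sinh y; independence and E D = 0 remove the sinh term. Taking
b = a / t matches the two transforms. -/
lemma map_direction_mul_displacement [IsProbabilityMeasure μ]
    (hN : IsRegularPoissonProcess lam N μ) (hlam : 0 < lam) {D : Ω → ℝ} (hD : Measurable D)
    (h1 : μ {ω | D ω = 1} = 1 / 2) (h2 : μ {ω | D ω = -1} = 1 / 2)
    (hind : IndepFun D (fun ω t => N t ω) μ) {t : ℝ≥0} (ht : 0 < t) :
    μ.map (fun ω => D ω * displacement N t ω / t) = telegraphMeasure (lam * t) := by
  have hT : (0 : ℝ) < lam * t := by positivity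
  have htpos : (0 : ℝ) < t := by positivity
  have hDae := ae_direction hD h1 h2
  have hD1 : ∀ᵐ ω ∂μ, |D ω| ≤ 1 := by
    filter_upwards [hDae] with ω hω
    rcases hω with hω | hω <;> simp [hω]
  have hY := hN.measurable_displacement t
  have := isProbabilityMeasure_telegraphMeasure hT
  refine map_eq_of_mgf_eq_of_bounded (Z := fun ω => D ω * displacement N t ω / t) (C := 1)
    ((hD.mul hY).div_const _).aemeasurable ?_ ?_
  · filter_upwards [hD1] with ω hω
    rw [abs_div, abs_mul, abs_of_pos htpos, div_le_one htpos]
    refine (mul_le_of_le_one_left (abs_nonneg _) hω).trans ?_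
    simpa using abs_displacement_le (N := N) (t : ℝ) ω
  · funext a
    have hsplit : ∀ᵐ ω ∂μ, Real.exp (a * (D ω * displacement N t ω / t)) =
        Real.cosh (a / t * displacement N t ω) + D ω * Real.sinh (a / t * displacement N t ω) := by
      filter_upwards [hDae] with ω hω
      have e : a * (D ω * displacement N t ω / t) = D ω * (a / t * displacement N t ω) := by ring
      rw [e]
      rcases hω with hω | hω
      · rw [hω, one_mul, one_mul, Real.cosh_add_sinh]
      · rw [hω, neg_one_mul, neg_one_mul, ← sub_eq_add_neg, Real.cosh_sub_sinh]
    have hbd : ∀ ω, a / t * displacement N t ω ∈ Icc (-|a|) |a| := by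
      intro ω
      rw [mem_Icc, ← abs_le, abs_mul, abs_div, abs_of_pos htpos, div_mul_eq_mul_div,
        div_le_iff₀ htpos]
      gcongr
      simpa using abs_displacement_le (N := N) (t : ℝ) ω
    have hint : ∀ {g : ℝ → ℝ}, Continuous g →
        Integrable (fun ω => g (a / t * displacement N t ω)) μ := by
      intro g hg
      obtain ⟨M, hM⟩ := (isCompact_Icc (a := -|a|) (b := |a|)).exists_bound_of_continuousOn
        hg.continuousOn
      exact .of_bound (hg.measurable.comp (hY.const_mul _)).aestronglyMeasurable M
        (.of_forall fun ω => hM _ (hbd ω))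
    have hzero : ∫ ω, D ω * Real.sinh (a / t * displacement N t ω) ∂μ = 0 := by
      rw [hN.integral_direction_mul_comp hD hD1 hind t
        (g := fun y => Real.sinh (a / t * y)) (by fun_prop), integral_direction hD h1 h2, zero_mul]
    have hsinh : Integrable (fun ω => D ω * Real.sinh (a / t * displacement N t ω)) μ :=
      (hint Real.continuous_sinh).bdd_mul hD.aestronglyMeasurable (c := 1) hD1
    rw [mgf_telegraphMeasure hT, mgf, integral_congr_ae hsplit,
      integral_add (hint Real.continuous_cosh) hsinh, hzero, add_zero,
      hN.integral_cosh_displacement hlam _ t.coe_nonneg]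
    have hsq : √((lam * t : ℝ) ^ 2 + a ^ 2) = √((lam : ℝ) ^ 2 + (a / t) ^ 2) * t := by
      rw [← Real.sqrt_sq htpos.le, ← Real.sqrt_mul (by positivity), Real.sqrt_sq htpos.le]
      congr 1
      field_simp
    rw [hsq, mul_div_mul_right _ _ htpos.ne', neg_mul]

end IsRegularPoissonProcess

/-- The telegraph process, rescaled to `[-1, 1]`, in terms of a regular Poisson process. -/
lemma IsTelegraphProcess.exists_law {Ω : Type*} [MeasurableSpace Ω] {μ : Measure Ω}
    [IsProbabilityMeasure μ] {c : ℝ} {lam : ℝ≥0} (hlam : 0 < lam)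
    {X : ℝ≥0 → Ω → ℝ} (hX : IsTelegraphProcess c lam X μ) {t : ℝ≥0} (ht : 0 < t) :
    ∃ Z : Ω → ℝ, Measurable Z ∧ (∀ᵐ ω ∂μ, |Z ω| ≤ 1) ∧ (∀ᵐ ω ∂μ, X t ω = c * t * Z ω) ∧
      μ.map Z = telegraphMeasure (lam * t) := by
  obtain ⟨D, N, hD, h1, h2, hN, hind, hXeq⟩ := hX
  obtain ⟨N', hN', hae⟩ := hN.exists_regular
  have hind' : IndepFun D (fun ω t => N' t ω) μ := by
    refine hind.congr (.refl _ _) ?_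
    filter_upwards [hae] with ω hω
    exact funext fun t => (hω t).symm
  have htpos : (0 : ℝ) < t := by positivity
  refine ⟨fun ω => D ω * displacement N' t ω / t,
    (hD.mul (hN'.measurable_displacement t)).div_const _, ?_, ?_,
    hN'.map_direction_mul_displacement hlam hD h1 h2 hind' ht⟩
  · filter_upwards [ae_direction hD h1 h2] with ω hω
    have hω' : |D ω| ≤ 1 := by rcases hω with hω | hω <;> simp [hω]
    rw [abs_div, abs_mul, abs_of_pos htpos, div_le_one htpos]
    refine (mul_le_of_le_one_left (abs_nonneg _) hω').trans ?_
    simpa using abs_displacement_le (N := N') (t : ℝ) ω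
  · filter_upwards [hXeq, hae] with ω hω hω'
    rw [hω t, telegraphPosition, intervalIntegral.integral_const_mul]
    simp only [displacement, parity, hω']
    field_simp

end

theorem proposition2 {Ω : Type*} [MeasurableSpace Ω] (μ : Measure Ω) [IsProbabilityMeasure μ]
    (c : ℝ) (hc : 0 < c) (lam : ℝ≥0) (hlam : 0 < lam)
    (X : ℝ≥0 → Ω → ℝ) (hX : IsTelegraphProcess c lam X μ)
    (t : ℝ≥0) (ht : 0 < t) (x : ℝ) :
    (x ≤ -(c * t) → μ.real {ω | X t ω < x} = 0) ∧
    (-(c * t) < x → x ≤ c * t →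
      Summable (telegraphTerm c lam t x) ∧
      μ.real {ω | X t ω < x} =
        1 / 2 + lam * x * Real.exp (-(lam * t)) / (2 * c) * ∑' k : ℕ, telegraphTerm c lam t x k) ∧
    (c * t < x → μ.real {ω | X t ω < x} = 1) := by
  obtain ⟨Z, hZm, hZ1, hXZ, hlaw⟩ := hX.exists_law hlam ht
  have htpos : (0 : ℝ) < t := by positivity
  have hct : 0 < c * t := by positivity
  have hT : (0 : ℝ) < lam * t := by positivity
  refine ⟨fun hx => ?_, fun hx1 hx2 => ?_, fun hx => ?_⟩
  · have h : ∀ᵐ ω ∂μ, ω ∉ {ω | X t ω < x} := by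
      filter_upwards [hZ1, hXZ] with ω h1 h2
      rw [h2, not_lt]
      nlinarith [(abs_le.1 h1).1]
    rw [measureReal_def, measure_eq_zero_iff_ae_notMem.2 h, ENNReal.toReal_zero]
  · have hz0 : -1 < x / (c * t) := by rw [lt_div_iff₀ hct]; linarith
    have hz1 : x / (c * t) ≤ 1 := by rw [div_le_iff₀ hct]; linarith
    obtain ⟨hsum, hval⟩ := telegraphMeasure_real_Iio hT hz0 hz1
    have hterm : ∀ k, telegraphTerm c lam t x k = telegraphWeight (lam * t) k *
        ₂F₁ (-(k : ℝ)) (1 / 2 : ℝ) (3 / 2 : ℝ) ((x / (c * t)) ^ 2) := by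
      intro k
      rw [telegraphTerm, telegraphWeight, div_pow x, mul_pow c]
    have hev : {ω | X t ω < x} =ᵐ[μ] Z ⁻¹' Set.Iio (x / (c * t)) := by
      filter_upwards [hXZ] with ω h
      refine propext ?_
      change X t ω < x ↔ Z ω < x / (c * t)
      rw [h, lt_div_iff₀ hct, mul_comm (Z ω)]
    refine ⟨hsum.congr fun k => (hterm k).symm, ?_⟩
    rw [measureReal_congr hev, ← map_measureReal_apply hZm measurableSet_Iio, hlaw, hval,
      tsum_congr hterm]
    field_simp
  · have h : ∀ᵐ ω ∂μ, X t ω < x := by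
      filter_upwards [hZ1, hXZ] with ω h1 h2
      rw [h2]
      nlinarith [(abs_le.1 h1).2]
    rw [measureReal_def, (prob_compl_eq_zero_iff₀ ?_).1, ENNReal.toReal_one]
    · exact h
    -- `X t` is not assumed measurable; the event is null-measurable because its complement is null.
    · exact NullMeasurableSet.of_compl (NullMeasurableSet.of_null h)
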